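/- For each $p$ that is zero or a prime, let $\mathbb{K}_p$ be an algebraically closed field of characteristic $p$ with a nontrivial valuation $v_p:\mathbb{K}_p^*\to\mathbb{R}$ whose residue field also has characteristic $p$. Let $H_{p,n}\subseteq\mathbb{R}^{n+1}$ be the closure of the set of $(a_0,\ldots,a_n)\in\mathbb{R}^{n+1}$ such that the tropical polynomial $a_0\oplus a_1x\oplus\cdots\oplus a_nx^n$ has $0$ as a tropical double root, that is, such that there are $F=\sum_{i=0}^n A_iX^i\in\mathbb{K}_p[X]$ with $v_p(A_i)=a_i$ for all $i$ and $B\in\mathbb{K}_p^*$ with $v_p(B)=0$ and $F(B)=F'(B)=0$. Let $U_n=H_{0,n}\cap\bigcap_{p\text{ prime}}H_{p,n}$ be the set of universally singular polynomials of degree $n$. Cones are allowed to contain lines, the codimension of a cone is taken in $\mathbb{R}^{n+1}$, a maximal face of a fan is a cone of it that is maximal for inclusion, and a fan is pure if all its maximal faces have the same codimension. Let $p_1<p_2<\cdots$ be the primes and let $k(n)$ be the largest $k\ge 0$ with $2p_1\cdots p_k\le n$ ($k(n)=0$ if there is none). **Theorem.** There is an $N$, independent of the fields and valuations, such that for all $n\ge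 N$ the set $U_n$ is the support of a rational polyhedral fan, and every rational polyhedral fan with support $U_n$ has codimension $3$ (that is, $3$ is the least codimension of its cones) but is not pure; it has, for every $k\ge 1$ with $2p_1\cdots p_k\le n$, a maximal face of codimension $k+2$, and in particular one of codimension $c(n)=k(n)+2$. Here $c(n)=\mathcal{O}(\log n)$ and $\log n/\log\log n=\mathcal{O}(c(n))$ as $n\to\infty$. -/

import Mathlib

open Filter Asymptotics

noncomputable section

/-! ### Singular tropical polynomials in one variable -/

/-- The possible characteristics of a field: zero or a prime. -/
abbrev FieldChar : Type := {p : ℕ // p = 0 ∨ p.Prime}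

/-- The residue field of a real-valued valuation on a field. -/
abbrev TropResidueField {K : Type*} [Field K] (v : AddValuation K (WithTop ℝ)) : Type _ :=
  IsLocalRing.ResidueField (AddValuation.toValuation v).valuationSubring

/-- `b` is a singular point of the tropical polynomial `a₀ ⊕ a₁ x ⊕ ⋯ ⊕ aₙ xⁿ` with respect to `v`:
some `F = ∑ Aᵢ Xⁱ` with `v(Aᵢ) = aᵢ` for `0 ≤ i ≤ n` has a singular (that is, a double) root `B`
with `v(B) = b`. As the `aᵢ` and `b` are real numbers, all `Aᵢ` and `B` are nonzero. -/
def IsTropSingularPoint {K : Type*} [Field K] (v : AddValuation K (WithTop ℝ)) {n : ℕ}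
    (a : Fin (n + 1) → ℝ) (b : ℝ) : Prop :=
  ∃ (F : Polynomial K) (B : K), F.natDegree ≤ n ∧
    (∀ i : Fin (n + 1), v (F.coeff i) = ((a i : ℝ) : WithTop ℝ)) ∧
    v B = ((b : ℝ) : WithTop ℝ) ∧ F.eval B = 0 ∧ F.derivative.eval B = 0

/-- The tropical linear space `H_{p,n} ⊆ ℝⁿ⁺¹` (where `p` is the characteristic of `K`): the
closure of the set of tropical polynomials of degree `n` that have `0` as a tropical double root.
The closure accounts for value groups that are not all of `ℝ`. -/
def tropDoubleRootSpace {K : Type*} [Field K] (v : AddValuation K (WithTop ℝ)) (n : ℕ) :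
    Set (Fin (n + 1) → ℝ) :=
  closure {a | IsTropSingularPoint v a 0}

/-- The set of universally singular polynomials of degree `n`: the intersection of the spaces
`H_{p,n}` over all characteristics `p` (zero and all primes). -/
def universallySingular {K : FieldChar → Type*} [∀ p, Field (K p)]
    (v : ∀ p, AddValuation (K p) (WithTop ℝ)) (n : ℕ) : Set (Fin (n + 1) → ℝ) :=
  ⋂ p, tropDoubleRootSpace (v p) n

/-! ### Rational polyhedral fans

The cones are convex cones containing `0`; as usual for tropical varieties, they may contain
lines. -/

/-- A rational polyhedral cone: the solution set of finitely many homogeneous linear inequalities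
with integer coefficients. -/
def IsRationalPolyhedralCone {m : ℕ} (σ : PointedCone ℝ (Fin m → ℝ)) : Prop :=
  ∃ S : Finset (Fin m → ℤ), ∀ x : Fin m → ℝ, x ∈ σ ↔ ∀ u ∈ S, 0 ≤ ∑ i, (u i : ℝ) * x i

/-- A rational polyhedral fan in `ℝᵐ`. -/
structure RationalFan (m : ℕ) where
  cones : Set (PointedCone ℝ (Fin m → ℝ))
  finite : cones.Finite
  rational : ∀ σ ∈ cones, IsRationalPolyhedralCone σ
  face_mem : ∀ σ ∈ cones, ∀ τ : PointedCone ℝ (Fin m → ℝ), τ.IsFaceOf σ → τ ∈ cones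
  inter_face : ∀ σ ∈ cones, ∀ τ ∈ cones, (σ ⊓ τ).IsFaceOf σ

/-- The codimension in `ℝᵐ` of (the linear span of) a cone. -/
def coneCodim {m : ℕ} (σ : PointedCone ℝ (Fin m → ℝ)) : ℕ :=
  m - Module.finrank ℝ (Submodule.span ℝ (σ : Set (Fin m → ℝ)))

namespace RationalFan

variable {m : ℕ}

/-- The union of all cones of the fan. -/
def support (Φ : RationalFan m) : Set (Fin m → ℝ) :=
  ⋃ σ ∈ Φ.cones, (σ : Set (Fin m → ℝ))

/-- The maximal faces of a fan: its cones that are maximal for inclusion. -/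
def IsMaximalFace (Φ : RationalFan m) (σ : PointedCone ℝ (Fin m → ℝ)) : Prop :=
  Maximal (· ∈ Φ.cones) σ

/-- The codimension of the fan, the least codimension of one of its cones, is `c`. -/
def HasCodim (Φ : RationalFan m) (c : ℕ) : Prop :=
  IsLeast (coneCodim '' Φ.cones) c

/-- A fan is pure if all its maximal faces have the same codimension. -/
def IsPure (Φ : RationalFan m) : Prop :=
  ∃ c, ∀ σ, Φ.IsMaximalFace σ → coneCodim σ = c

end RationalFan

/-! ### Products of the first primes -/

/-- The product of the first `k` primes. -/
def firstPrimesProd (k : ℕ) : ℕ := ∏ i ∈ Finset.range k, Nat.nth Nat.Prime i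

/-- The largest `k` such that twice the product of the first `k` primes is at most `n` (and `0` if
there is none). The search bound `n` is no restriction, as that product is at least `2 ^ k`. -/
def maxPrimeCount (n : ℕ) : ℕ := Nat.findGreatest (fun k => 2 * firstPrimesProd k ≤ n) n

end

/-! Let `F(B) = F'(B) = 0` with `v(B) = 0`. The terms `x i = A i * B ^ i` have the valuations of the
`A i` and satisfy `∑ x i = ∑ i * x i = 0`, hence `∑ (i - c) * x i = 0` for every index `c`. As `K`
and its residue field have the same characteristic `p`, each `i - c` is zero or has valuation `0`,
so the minimum over the indices outside the class of `c` modulo `p` is attained twice. Conversely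
these conditions suffice, up to closure: vectors of small support in the kernel are combined
generically (`tropDoubleRootSpace_eq_bergmanFan`).

The conditions depend only on the weak order of the coordinates, so cones of weak orders form a fan
with support `U_n`. Characteristics `0` and `2` alone already force three independent equalities of
coordinates, whence codimension at least three.

For the large codimensions let `P` be a product of `k` primes `q`, including `2`. Take height `0` at
`0, P, 2P`, height `1` at `P/q` and `2P - P/q`, and height `2` elsewhere. A prime `q` dividing `P`
does not see the lowest level outside the class of `0`, and must find its minimum twice at its own
pair; all other conditions hold on the lowest level. So near this point `U_n` is a linear space cut
out by `k + 2` equalities, and any fan with this support has a maximal face spanning it. The growth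
of `k` comes from `2 ^ k ≤ p_1 ⋯ p_k` and a polynomial bound on the primes. -/

/-! ### Combinatorial Bergman fans -/

/-- The minimum of `a` over `S` is attained at least twice. -/
def MinAttainedTwice {ι : Type*} (S : Set ι) (a : ι → ℝ) : Prop :=
  ∃ i ∈ S, ∃ j ∈ S, i ≠ j ∧ ∀ k ∈ S, a i ≤ a k ∧ a j ≤ a k

/-- The combinatorial description of the tropical linear space of polynomials with double root `0`
in characteristic `p`: for each residue class `c` modulo `p`, the minimum of the coefficients whose
index is not in `c` is attained at least twice. -/
def bergmanFan (p n : ℕ) : Set (Fin (n + 1) → ℝ) :=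
  {a | ∀ c : Fin (n + 1), MinAttainedTwice {k : Fin (n + 1) | ¬ (k : ℕ) ≡ c [MOD p]} a}

theorem isClosed_setOf_minAttainedTwice {ι : Type*} [Finite ι] (S : Set ι) :
    IsClosed {a : ι → ℝ | MinAttainedTwice S a} := by
  have : {a : ι → ℝ | MinAttainedTwice S a} =
      ⋃ i : S, ⋃ j : {j : S // (i : ι) ≠ j}, ⋂ k : S, {a | a i ≤ a k ∧ a (j : S) ≤ a k} := by
    ext a
    simp only [MinAttainedTwice, Set.mem_ofPred_eq, Set.mem_iUnion, Set.mem_iInter, Subtype.exists,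
      Subtype.forall, exists_prop]
  rw [this]
  refine isClosed_iUnion_of_finite fun i => isClosed_iUnion_of_finite fun j =>
    isClosed_iInter fun k => ?_
  exact (isClosed_le (continuous_apply (i : ι)) (continuous_apply (k : ι))).inter
    (isClosed_le (continuous_apply ((j : S) : ι)) (continuous_apply (k : ι)))

theorem isClosed_bergmanFan (p n : ℕ) : IsClosed (bergmanFan p n) := by
  rw [bergmanFan, Set.ofPred_forall]
  exact isClosed_iInter fun c => isClosed_setOf_minAttainedTwice _

theorem MinAttainedTwice.of_monotone {ι : Type*} {S : Set ι} {a b : ι → ℝ}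
    (h : MinAttainedTwice S a) (hab : ∀ i j, a i ≤ a j → b i ≤ b j) : MinAttainedTwice S b := by
  obtain ⟨i, hi, j, hj, hij, h⟩ := h
  exact ⟨i, hi, j, hj, hij, fun k hk => ⟨hab _ _ (h k hk).1, hab _ _ (h k hk).2⟩⟩

theorem mem_bergmanFan_of_monotone {p n : ℕ} {a b : Fin (n + 1) → ℝ} (h : a ∈ bergmanFan p n)
    (hab : ∀ i j, a i ≤ a j → b i ≤ b j) : b ∈ bergmanFan p n :=
  fun c => (h c).of_monotone hab

/-! ### Double roots satisfy the combinatorial conditions -/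

section Valuation

variable {K : Type*} [Field K] (v : AddValuation K (WithTop ℝ))

theorem AddValuation.mem_toValuation_valuationSubring {x : K} :
    x ∈ (AddValuation.toValuation v).valuationSubring ↔ 0 ≤ v x := Iff.rfl

theorem AddValuation.residue_eq_zero_iff (x : (AddValuation.toValuation v).valuationSubring) :
    (IsLocalRing.residue _ x : TropResidueField v) = 0 ↔ 0 < v (x : K) := by
  rw [IsLocalRing.residue_eq_zero_iff, Valuation.mem_maximalIdeal_iff]
  exact Iff.rfl

theorem AddValuation.zero_le_intCast (m : ℤ) : 0 ≤ v (m : K) :=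
  (v.mem_toValuation_valuationSubring).1 (intCast_mem _ m)

/-- Equal characteristic enters here: an integer vanishing in the residue field is divisible by `p`
and so vanishes in `K`. -/
theorem AddValuation.intCast_eq_zero_of_ne_zero (p : ℕ) [CharP K p] [CharP (TropResidueField v) p]
    {m : ℤ} (hm : (m : K) ≠ 0) : v (m : K) = 0 := by
  refine le_antisymm (not_lt.1 fun h => hm ?_) (v.zero_le_intCast m)
  have h0 := (v.residue_eq_zero_iff (m : (AddValuation.toValuation v).valuationSubring)).2
    (by simpa using h)
  rw [map_intCast, CharP.intCast_eq_zero_iff _ p] at h0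
  exact (CharP.intCast_eq_zero_iff K p m).2 h0

theorem AddValuation.map_natCast_sub (p : ℕ) [CharP K p] [CharP (TropResidueField v) p]
    {i j : ℕ} (hij : ¬ i ≡ j [MOD p]) : v ((i : K) - j) = 0 := by
  have h := v.intCast_eq_zero_of_ne_zero p (m := (i : ℤ) - j) (by
    push_cast
    rw [sub_ne_zero]
    exact fun h => hij ((CharP.natCast_eq_natCast K p).1 h))
  simpa using h

/-- Evaluating `X F' - c F` at a double root. -/
theorem sum_sub_mul_coeff_eq_zero {n : ℕ} {F : Polynomial K} {B : K} (hF : F.natDegree ≤ n)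
    (h0 : F.eval B = 0) (h1 : F.derivative.eval B = 0) (c : K) :
    ∑ i : Fin (n + 1), ((i : ℕ) - c) * (F.coeff i * B ^ (i : ℕ)) = 0 := by
  have e0 : ∑ i ∈ Finset.range (n + 1), F.coeff i * B ^ i = 0 := by
    rw [← Polynomial.eval_eq_sum_range' (Nat.lt_succ_of_le hF), h0]
  have e1 : ∑ i ∈ Finset.range (n + 1), (i : K) * (F.coeff i * B ^ i) = 0 := by
    have : (Polynomial.X * F.derivative).eval B = 0 := by simp [h1]
    rw [Polynomial.eval_eq_sum_range' (n := n + 1)] at this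
    · rw [← this]
      refine Finset.sum_congr rfl fun i _ => ?_
      rcases i with _ | i
      · simp
      · rw [Polynomial.coeff_X_mul, Polynomial.coeff_derivative]
        push_cast
        ring
    · by_cases hd : F.natDegree = 0
      · rw [Polynomial.derivative_of_natDegree_zero hd, mul_zero, Polynomial.natDegree_zero]
        omega
      · have := Polynomial.natDegree_derivative_lt hd
        refine (Polynomial.natDegree_mul_le).trans_lt ?_
        rw [Polynomial.natDegree_X]
        omega
  rw [Fin.sum_univ_eq_sum_range (fun i => ((i : K) - c) * (F.coeff i * B ^ i)) (n + 1)]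
  simp only [sub_mul, Finset.sum_sub_distrib, ← Finset.mul_sum, e0, e1, mul_zero,
    sub_zero]

/-- By the ultrametric inequality a term of strictly smallest valuation cannot be cancelled by the
others. -/
theorem minAttainedTwice_of_sum_eq_zero {ι : Type*} [Fintype ι] {S : Set ι} (hS : S.Nonempty)
    {a : ι → ℝ} {x : ι → K} (hx : ∑ i, x i = 0) (hxS : ∀ i ∈ S, v (x i) = (a i : WithTop ℝ))
    (hxS' : ∀ i ∉ S, x i = 0) : MinAttainedTwice S a := by
  classical
  obtain ⟨i, hi, hmin⟩ := Set.exists_min_image S a S.toFinite hS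
  by_contra hcon
  have hlt : ∀ j ∈ S, j ≠ i → a i < a j := by
    intro j hj hji
    refine lt_of_le_of_ne (hmin j hj) fun h => hcon ⟨i, hi, j, hj, hji.symm, fun k hk => ?_⟩
    exact ⟨hmin k hk, h ▸ hmin k hk⟩
  have h1 : (a i : WithTop ℝ) < v (∑ j ∈ Finset.univ.erase i, x j) := by
    refine v.map_lt_sum (WithTop.coe_ne_top) fun j hj => ?_
    by_cases hjS : j ∈ S
    · rw [hxS j hjS]
      exact WithTop.coe_lt_coe.2 (hlt j hjS (Finset.ne_of_mem_erase hj))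
    · rw [hxS' j hjS, v.map_zero]
      exact WithTop.coe_lt_top _
  rw [← Finset.add_sum_erase _ _ (Finset.mem_univ i), add_eq_zero_iff_eq_neg] at hx
  rw [← v.map_neg, ← hx, hxS i hi] at h1
  exact lt_irrefl _ h1

theorem IsTropSingularPoint.mem_bergmanFan {p n : ℕ} [CharP K p] [CharP (TropResidueField v) p]
    (hp : p ≠ 1) (hn : 1 ≤ n) {a : Fin (n + 1) → ℝ} (ha : IsTropSingularPoint v a 0) :
    a ∈ bergmanFan p n := by
  obtain ⟨F, B, hF, hv, hB, h0, h1⟩ := ha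
  intro c
  refine minAttainedTwice_of_sum_eq_zero v ?_ (sum_sub_mul_coeff_eq_zero hF h0 h1 (c : ℕ)) ?_ ?_
  -- A neighbour of `c` lies outside its class because `p ≠ 1`; it is `c + 1`, or `c - 1` at the
  -- right end.
  · have key : ∀ m : ℕ, ¬ m ≡ m + 1 [MOD p] := fun m h => by
      have := (Nat.modEq_iff_dvd' (Nat.le_succ m)).1 h
      simp at this
      exact hp this
    rcases Nat.lt_or_ge (c : ℕ) n with h | h
    · exact ⟨⟨c + 1, by omega⟩, fun h => key _ h.symm⟩
    · refine ⟨⟨c - 1, by omega⟩, fun h' => key (c - 1) ?_⟩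
      rwa [Nat.sub_add_cancel (by omega)]
  · intro i hi
    rw [v.map_mul, v.map_mul, v.map_natCast_sub p hi, v.map_pow, hB, hv]
    simp
  · intro i hi
    simp only [Set.mem_ofPred_eq, not_not] at hi
    rw [(CharP.natCast_eq_natCast K p).2 hi, sub_self, zero_mul]


/-! ### Lifting points of the Bergman fan to polynomials -/

/-- Over a residue field with `q` elements, a root of `X ^ q - X - 1`, which is necessarily
integral, would reduce to a solution of `0 = 1`. -/
theorem AddValuation.infinite_residueField [IsAlgClosed K] : Infinite (TropResidueField v) := by
  by_contra hfin
  rw [not_infinite_iff_finite] at hfin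
  have := Fintype.ofFinite (TropResidueField v)
  set q := Fintype.card (TropResidueField v) with hq
  have hq1 : 1 < q := Fintype.one_lt_card
  obtain ⟨x, hx⟩ := IsAlgClosed.exists_root (Polynomial.X ^ q - Polynomial.X - 1 : Polynomial K) (by
    have : (Polynomial.X ^ q - Polynomial.X - 1 : Polynomial K).degree = q := by
      rw [sub_sub, Polynomial.degree_sub_eq_left_of_degree_lt] <;> rw [Polynomial.degree_X_pow]
      refine (Polynomial.degree_add_le _ _).trans_lt ?_
      simpa using hq1
    rw [this]
    exact_mod_cast (by omega : q ≠ 0))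
  have hx' : x ^ q - x = 1 := by
    simpa [Polynomial.IsRoot, sub_eq_zero] using hx
  have hv : 0 ≤ v x := by
    by_contra hneg
    rw [not_le] at hneg
    have hlt : v (x ^ q) < v x := by
      rw [v.map_pow]
      lift v x to ℝ using hneg.ne_top with r
      norm_cast at hneg ⊢
      rw [nsmul_eq_mul]
      have : (1 : ℝ) < q := by exact_mod_cast hq1
      nlinarith
    have h1 := v.map_sub_eq_of_lt_left hlt
    rw [hx', v.map_one] at h1
    exact lt_asymm hneg (h1 ▸ hlt)
  have h1 := congrArg (IsLocalRing.residue (AddValuation.toValuation v).valuationSubring)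
    (Subtype.ext hx' : (⟨x, hv⟩ : (AddValuation.toValuation v).valuationSubring) ^ q - ⟨x, hv⟩ = 1)
  rw [_root_.map_sub, _root_.map_pow, _root_.map_one, FiniteField.pow_card, sub_self] at h1
  exact zero_ne_one h1

theorem AddValuation.exists_infinite_set_map_sub_eq_zero [IsAlgClosed K] :
    ∃ Λ : Set K, Λ.Infinite ∧ (∀ x ∈ Λ, 0 ≤ v x) ∧ ∀ x ∈ Λ, ∀ y ∈ Λ, x ≠ y → v (x - y) = 0 := by
  have := v.infinite_residueField
  let s : TropResidueField v → (AddValuation.toValuation v).valuationSubring :=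
    Function.surjInv IsLocalRing.residue_surjective
  have hs : ∀ x, IsLocalRing.residue _ (s x) = x :=
    Function.surjInv_eq IsLocalRing.residue_surjective
  refine ⟨Set.range fun x => (s x : K), Set.infinite_range_of_injective ?_, ?_, ?_⟩
  · intro x y hxy
    rw [← hs x, ← hs y, Subtype.ext hxy]
  · rintro _ ⟨x, rfl⟩
    exact (s x).2
  · rintro _ ⟨x, rfl⟩ _ ⟨y, rfl⟩ hxy
    refine le_antisymm (not_lt.1 fun h => hxy ?_) (s x - s y).2
    have h0 := (v.residue_eq_zero_iff (s x - s y)).2 h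
    rw [_root_.map_sub, hs, hs, sub_eq_zero] at h0
    rw [h0]

/-- A submodule contains a vector of prescribed valuations as soon as it contains, for each
coordinate, a vector attaining the prescribed valuation there and dominated by it elsewhere. -/
theorem exists_mem_forall_map_eq [IsAlgClosed K] {ι : Type*} [Fintype ι] (W : Submodule K (ι → K))
    (a : ι → ℝ) (h : ∀ l, ∃ x ∈ W, v (x l) = (a l : WithTop ℝ) ∧ ∀ j, (a j : WithTop ℝ) ≤ v (x j)) :
    ∃ x ∈ W, ∀ j, v (x j) = (a j : WithTop ℝ) := by
  classical
  obtain ⟨Λ, hΛ, hΛ0, hΛ1⟩ := v.exists_infinite_set_map_sub_eq_zero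
  suffices H : ∀ s : Finset ι, ∃ x ∈ W, (∀ j ∈ s, v (x j) = (a j : WithTop ℝ)) ∧
      ∀ j, (a j : WithTop ℝ) ≤ v (x j) by
    obtain ⟨x, hx, hxs, -⟩ := H Finset.univ
    exact ⟨x, hx, fun j => hxs j (Finset.mem_univ j)⟩
  intro s
  induction s using Finset.induction_on with
  | empty => exact ⟨0, W.zero_mem, by simp, by simp⟩
  | insert l s _ ih =>
    obtain ⟨x, hx, hxs, hxa⟩ := ih
    obtain ⟨y, hy, hyl, hya⟩ := h l
    have hle : ∀ t ∈ Λ, ∀ j, (a j : WithTop ℝ) ≤ v (x j + t * y j) := fun t ht j => by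
      refine v.map_le_add (hxa j) ?_
      rw [v.map_mul]
      exact (hya j).trans (le_add_of_nonneg_left (hΛ0 t ht))
    -- Two bad values of `t` at `j` would make `v (y j)` too large, which contradicts the choice of
    -- `y` if `j = l` and that of `x` otherwise. So infinitely many `t` remain.
    have hbad : ∀ j ∈ insert l s, {t ∈ Λ | (a j : WithTop ℝ) < v (x j + t * y j)}.Subsingleton := by
      rintro j hj t ⟨ht, hjt⟩ t' ⟨ht', hjt'⟩
      by_contra hne
      have hyj : (a j : WithTop ℝ) < v (y j) := by
        have h1 : (a j : WithTop ℝ) < v ((x j + t * y j) - (x j + t' * y j)) :=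
          (lt_min hjt hjt').trans_le (v.map_sub _ _)
        rwa [add_sub_add_left_eq_sub, ← sub_mul, v.map_mul, hΛ1 t ht t' ht' hne, zero_add] at h1
      rcases Finset.mem_insert.1 hj with rfl | hj
      · exact hyj.ne hyl.symm
      · have h1 : (a j : WithTop ℝ) < v ((x j + t * y j) - t * y j) := by
          refine (lt_min hjt ?_).trans_le (v.map_sub _ _)
          rw [v.map_mul]
          exact hyj.trans_le (le_add_of_nonneg_left (hΛ0 t ht))
        rw [add_sub_cancel_right, hxs j hj] at h1
        exact lt_irrefl _ h1
    obtain ⟨t, ht, htj⟩ := hΛ.exists_notMem_finite (Set.Finite.biUnion (insert l s).finite_toSet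
      fun j hj => (hbad j hj).finite)
    refine ⟨x + t • y, W.add_mem hx (W.smul_mem t hy), fun j hj => ?_, hle t ht⟩
    refine le_antisymm (not_lt.1 fun hlt => htj ?_) (hle t ht j)
    exact Set.mem_biUnion (Finset.mem_coe.2 hj) ⟨ht, hlt⟩

/-- The vector is supported on `l` and one or two indices of no larger height: `i` is minimal
outside the class of `l`, and `j ≠ l` is minimal outside the class of `i`. If `j` is congruent to
`l`, a difference of two unit vectors works; otherwise the linear relation among three points does,
with all coefficients of valuation `0`. -/
theorem exists_mem_kernel_of_mem_bergmanFan {p n : ℕ} [CharP K p] [CharP (TropResidueField v) p]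
    {a : Fin (n + 1) → ℝ} (ha : a ∈ bergmanFan p n) {t : Fin (n + 1) → K}
    (ht : ∀ i, v (t i) = (a i : WithTop ℝ)) (l : Fin (n + 1)) :
    ∃ x : Fin (n + 1) → K, (∑ i, x i = 0 ∧ ∑ i : Fin (n + 1), ((i : ℕ) : K) * x i = 0) ∧
      v (x l) = (a l : WithTop ℝ) ∧ ∀ j, (a j : WithTop ℝ) ≤ v (x j) := by
  obtain ⟨i, hi, i', hi', hne, hmin⟩ := ha l
  obtain ⟨j, hj, hjl, hjmin⟩ : ∃ j : Fin (n + 1), ¬ (j : ℕ) ≡ i [MOD p] ∧ j ≠ l ∧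
      ∀ k : Fin (n + 1), ¬ (k : ℕ) ≡ i [MOD p] → a j ≤ a k := by
    obtain ⟨j, hj, j', hj', hne, h⟩ := ha i
    by_cases hjl : j = l
    · exact ⟨j', hj', fun h' => hne (hjl.trans h'.symm), fun k hk => (h k hk).2⟩
    · exact ⟨j, hj, hjl, fun k hk => (h k hk).1⟩
  have hajl : a j ≤ a l := hjmin l fun h => hi h.symm
  have hil : i ≠ l := fun h => hi (h ▸ rfl)
  have hij : i ≠ j := fun h => hj (h ▸ rfl)
  by_cases hjl' : (j : ℕ) ≡ l [MOD p]
  · have hK := (CharP.natCast_eq_natCast K p).2 hjl'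
    refine ⟨Pi.single l (t l) - Pi.single j (t l), ⟨?_, ?_⟩, ?_, ?_⟩
    · simp
    · simp [mul_sub, Pi.single_apply, Finset.sum_sub_distrib, hK]
    · simp [hjl.symm, ht]
    · intro k
      rcases eq_or_ne k l with rfl | hkl
      · simp [hjl.symm, ht]
      rcases eq_or_ne k j with rfl | hkj
      · simpa [hjl, ht] using hajl
      · simp [hkl, hkj]
  · have haij : a i ≤ a j := (hmin j hjl').1
    have h1 := v.map_natCast_sub p fun h : (i : ℕ) ≡ j [MOD p] => hj h.symm
    have h2 := v.map_natCast_sub p hjl'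
    have h3 := v.map_natCast_sub p fun h : (l : ℕ) ≡ i [MOD p] => hi h.symm
    have h0 : ((i : ℕ) : K) - (j : ℕ) ≠ 0 := by
      rw [← v.ne_top_iff, h1]
      exact WithTop.zero_ne_top
    refine ⟨Pi.single l (t l) + (Pi.single i (t l * ((j - l : K) / (i - j))) +
      Pi.single j (t l * ((l - i : K) / (i - j)))), ⟨?_, ?_⟩, ?_, ?_⟩
    · simp [Finset.sum_add_distrib]
      field_simp
      ring
    · simp [mul_add, Pi.single_apply, Finset.sum_add_distrib]
      field_simp
      ring
    · simp [hjl.symm, hil.symm, ht]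
    · intro k
      rcases eq_or_ne k l with rfl | hkl
      · simp [hjl.symm, hil.symm, ht]
      rcases eq_or_ne k j with rfl | hkj
      · simpa [Pi.single_apply, hjl, hij.symm, ht, h1, h2, h3] using hajl
      rcases eq_or_ne k i with rfl | hki
      · simpa [Pi.single_apply, hil, hij, ht, h1, h2, h3] using haij.trans hajl
      · simp [hkl, hkj, hki]

theorem isTropSingularPoint_of_mem_bergmanFan [IsAlgClosed K] {p n : ℕ} [CharP K p]
    [CharP (TropResidueField v) p] {a : Fin (n + 1) → ℝ} (ha : a ∈ bergmanFan p n)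
    (hΓ : ∀ i, ∃ t, v t = (a i : WithTop ℝ)) : IsTropSingularPoint v a 0 := by
  choose t ht using hΓ
  let f : (Fin (n + 1) → K) →ₗ[K] K := ∑ i, LinearMap.proj i
  let g : (Fin (n + 1) → K) →ₗ[K] K := ∑ i : Fin (n + 1), ((i : ℕ) : K) • LinearMap.proj i
  have hW : ∀ x, x ∈ LinearMap.ker f ⊓ LinearMap.ker g ↔
      (∑ i, x i = 0 ∧ ∑ i : Fin (n + 1), ((i : ℕ) : K) * x i = 0) := by
    simp [f, g]
  obtain ⟨x, hx, hxa⟩ := exists_mem_forall_map_eq v (LinearMap.ker f ⊓ LinearMap.ker g) a fun l => by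
    simpa only [hW] using exists_mem_kernel_of_mem_bergmanFan v ha ht l
  rw [hW] at hx
  refine ⟨∑ i : Fin (n + 1), Polynomial.monomial i (x i), 1, ?_, ?_, by simp, ?_, ?_⟩
  · refine Polynomial.natDegree_sum_le_of_forall_le _ _ fun i _ => ?_
    exact (Polynomial.natDegree_monomial_le _).trans (Nat.lt_succ_iff.1 i.2)
  · intro i
    rw [← hxa i, Polynomial.finsetSum_coeff]
    simp [Polynomial.coeff_monomial, Fin.val_inj]
  · simpa [Polynomial.eval_finsetSum] using hx.1
  · simpa [Polynomial.eval_finsetSum, mul_comm, Polynomial.derivative_monomial] using hx.2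

/-! ### Density of the value group -/

/-- Extracting an `m`-th root divides the valuation by `m`. -/
theorem AddValuation.exists_map_eq_coe_of_mem_Ioo [IsAlgClosed K] (hv : ∃ x : K, x ≠ 0 ∧ v x ≠ 0)
    {ε : ℝ} (hε : 0 < ε) : ∃ γ, 0 < γ ∧ γ < ε ∧ ∃ x : K, v x = (γ : WithTop ℝ) := by
  obtain ⟨x, r, hr, hx⟩ : ∃ (x : K) (r : ℝ), 0 < r ∧ v x = (r : WithTop ℝ) := by
    obtain ⟨x, hx0, hx⟩ := hv
    obtain ⟨r, hr⟩ := WithTop.ne_top_iff_exists.1 (v.ne_top_iff.2 hx0)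
    rw [← hr] at hx
    norm_cast at hx
    rcases lt_or_gt_of_ne hx with h | h
    · refine ⟨x⁻¹, -r, neg_pos.2 h, ?_⟩
      rw [v.map_inv, ← hr]
      rfl
    · exact ⟨x, r, h, hr.symm⟩
  obtain ⟨m, hm⟩ := exists_nat_gt (r / ε)
  have hm0 : 0 < m := by
    have : (0 : ℝ) < m := (div_pos hr hε).trans hm
    exact_mod_cast this
  have hm0' : (0 : ℝ) < m := by exact_mod_cast hm0
  obtain ⟨y, hy⟩ := IsAlgClosed.exists_pow_nat_eq x hm0
  refine ⟨r / m, div_pos hr hm0', ?_, y, ?_⟩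
  · rw [div_lt_iff₀ hm0']
    rwa [div_lt_iff₀ hε, mul_comm] at hm
  · have h1 : m • v y = (r : WithTop ℝ) := by rw [← v.map_pow, hy, hx]
    have hy0 : v y ≠ ⊤ := by
      rw [v.ne_top_iff]
      rintro rfl
      rw [zero_pow hm0.ne'] at hy
      rw [← hy, v.map_zero] at hx
      exact WithTop.top_ne_coe hx
    lift v y to ℝ using hy0 with s
    norm_cast at h1 ⊢
    rw [nsmul_eq_mul] at h1
    rw [← h1]
    field_simp

theorem AddValuation.exists_map_eq_intCast_mul {γ : ℝ} (h : ∃ x : K, v x = (γ : WithTop ℝ)) (m : ℤ) :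
    ∃ x : K, v x = ((m * γ : ℝ) : WithTop ℝ) := by
  obtain ⟨x, hx⟩ := h
  obtain ⟨k, rfl | rfl⟩ := m.eq_nat_or_neg
  · refine ⟨x ^ k, ?_⟩
    rw [v.map_pow, hx]
    norm_cast
    simp
  · refine ⟨(x ^ k)⁻¹, ?_⟩
    rw [v.map_inv, v.map_pow, hx]
    norm_cast
    simp

/-- Rounding all coordinates down to multiples of a small `γ` in the value group is monotone, so it
stays in the Bergman fan while moving the point by at most `γ`. -/
theorem tropDoubleRootSpace_eq_bergmanFan [IsAlgClosed K] {p n : ℕ} [CharP K p]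
    [CharP (TropResidueField v) p] (hv : ∃ x : K, x ≠ 0 ∧ v x ≠ 0) (hp : p ≠ 1) (hn : 1 ≤ n) :
    tropDoubleRootSpace v n = bergmanFan p n := by
  refine Set.Subset.antisymm ?_ fun a ha => ?_
  · exact closure_minimal (fun a ha => ha.mem_bergmanFan v hp hn) (isClosed_bergmanFan p n)
  · refine Metric.mem_closure_iff.2 fun ε hε => ?_
    obtain ⟨γ, hγ, hγε, hx⟩ := v.exists_map_eq_coe_of_mem_Ioo hv hε
    refine ⟨fun i => ⌊a i / γ⌋ * γ, ?_, ?_⟩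
    · refine isTropSingularPoint_of_mem_bergmanFan v (mem_bergmanFan_of_monotone ha fun i j hij => ?_)
        fun i => v.exists_map_eq_intCast_mul hx _
      have : ⌊a i / γ⌋ ≤ ⌊a j / γ⌋ := Int.floor_le_floor (by gcongr)
      gcongr
    · refine ((dist_pi_le_iff hγ.le).2 fun i => ?_).trans_lt hγε
      rw [Real.dist_eq, abs_le]
      have h1 := Int.floor_le (a i / γ)
      have h2 := Int.lt_floor_add_one (a i / γ)
      rw [le_div_iff₀ hγ] at h1
      rw [div_lt_iff₀ hγ] at h2
      constructor <;> linarith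

end Valuation

/-! ### Local structure of fans -/

/-- A convex cone contained in a finite union of subspaces is contained in one of them. -/
theorem PointedCone.exists_forall_mem_of_forall_exists_mem {E ι : Type*} [AddCommGroup E]
    [Module ℝ E] (σ : PointedCone ℝ E) (s : Finset ι) (W : ι → Submodule ℝ E)
    (h : ∀ x ∈ σ, ∃ i ∈ s, x ∈ W i) : ∃ i ∈ s, ∀ x ∈ σ, x ∈ W i := by
  classical
  by_contra! hcon
  suffices H : ∀ t ⊆ s, ∃ x ∈ σ, ∀ i ∈ t, x ∉ W i by
    obtain ⟨x, hx, hxs⟩ := H s subset_rfl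
    obtain ⟨i, hi, hxi⟩ := h x hx
    exact hxs i hi hxi
  intro t
  induction t using Finset.induction_on with
  | empty => exact fun _ => ⟨0, σ.zero_mem, by simp⟩
  | insert l t _ ih =>
    intro hts
    rw [Finset.insert_subset_iff] at hts
    obtain ⟨x, hx, hxt⟩ := ih hts.2
    obtain ⟨y, hy, hyl⟩ := hcon l hts.1
    -- The line `x + r • y` lies in none of these subspaces, since `y ∉ W l` and `x ∉ W i` for `i ∈
    -- t`, so it meets each at most once.
    have hbad : ∀ i ∈ insert l t, {r : ℝ | x + r • y ∈ W i}.Subsingleton := by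
      intro i hi r hr r' hr'
      by_contra hne
      have hyi : y ∈ W i := by
        have h1 := (W i).sub_mem hr hr'
        rw [add_sub_add_left_eq_sub, ← sub_smul] at h1
        exact ((W i).smul_mem_iff (sub_ne_zero.2 hne)).1 h1
      rcases Finset.mem_insert.1 hi with rfl | hi
      · exact hyl hyi
      · exact hxt i hi (((W i).add_mem_iff_left ((W i).smul_mem r hyi)).1 hr)
    obtain ⟨r, hr, hri⟩ := (Set.Ioi_infinite (0 : ℝ)).exists_notMem_finite
      (Set.Finite.biUnion (insert l t).finite_toSet fun i hi => (hbad i hi).finite)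
    refine ⟨x + r • y, σ.add_mem hx (σ.smul_mem (le_of_lt hr) hy), fun i hi hmem => hri ?_⟩
    exact Set.mem_biUnion (Finset.mem_coe.2 hi) hmem

theorem IsRationalPolyhedralCone.isClosed {m : ℕ} {σ : PointedCone ℝ (Fin m → ℝ)}
    (h : IsRationalPolyhedralCone σ) : IsClosed (σ : Set (Fin m → ℝ)) := by
  obtain ⟨S, hS⟩ := h
  have : (σ : Set (Fin m → ℝ)) = ⋂ u ∈ S, {x | 0 ≤ ∑ i, (u i : ℝ) * x i} := by
    ext x
    simpa using hS x
  rw [this]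
  exact isClosed_biInter fun u _ => isClosed_le continuous_const (by fun_prop)

/-- If the support of a fan agrees near a point with a subspace through that point, then some
maximal face of the fan spans this subspace. -/
theorem RationalFan.exists_isMaximalFace_span_eq {m : ℕ} (Φ : RationalFan m)
    (L : Submodule ℝ (Fin m → ℝ)) {a : Fin m → ℝ} (ha : a ∈ L)
    (h : ∀ᶠ x in nhds a, x ∈ Φ.support ↔ x ∈ L) :
    ∃ σ, Φ.IsMaximalFace σ ∧ Submodule.span ℝ (σ : Set (Fin m → ℝ)) = L := by
  classical
  have hline : ∀ y : Fin m → ℝ, Tendsto (fun t : ℝ => a + t • y) (nhdsWithin 0 (Set.Ioi 0))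
      (nhds a) := fun y => by
    have : Tendsto (fun t : ℝ => a + t • y) (nhds 0) (nhds (a + (0 : ℝ) • y)) :=
      Continuous.tendsto (by fun_prop) 0
    rw [zero_smul, add_zero] at this
    exact this.mono_left nhdsWithin_le_nhds
  have hsub : ∀ σ ∈ Φ.cones, a ∈ σ → ∀ y ∈ σ, y ∈ L := by
    intro σ hσ haσ y hy
    obtain ⟨t, ht, ht0⟩ := (((hline y).eventually h).and self_mem_nhdsWithin).exists
    have hmem : a + t • y ∈ σ := σ.add_mem haσ (σ.smul_mem (le_of_lt ht0) hy)
    have := (L.add_mem_iff_right ha).1 (ht.1 (Set.mem_biUnion hσ hmem))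
    exact (L.smul_mem_iff (ne_of_gt ht0)).1 this
  have hclosed : IsClosed (⋃ σ ∈ {σ ∈ Φ.cones | a ∉ σ}, (σ : Set (Fin m → ℝ))) :=
    (Φ.finite.subset (Set.sep_subset _ _)).isClosed_biUnion fun σ hσ => (Φ.rational σ hσ.1).isClosed
  have hfar : ∀ᶠ x in nhds a, x ∉ ⋃ σ ∈ {σ ∈ Φ.cones | a ∉ σ}, (σ : Set (Fin m → ℝ)) := by
    refine hclosed.isOpen_compl.mem_nhds ?_
    simp
  -- Near `a` only cones containing `a` matter, so a short step from `a` along `y` ends in such a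
  -- cone, whose span then contains `y`.
  have hcover : ∀ y ∈ L, ∃ σ ∈ Φ.cones, a ∈ σ ∧ y ∈ Submodule.span ℝ (σ : Set (Fin m → ℝ)) := by
    intro y hy
    obtain ⟨t, ⟨ht, htfar⟩, ht0⟩ :=
      (((hline y).eventually (h.and hfar)).and self_mem_nhdsWithin).exists
    obtain ⟨σ, hσ, hmem⟩ := Set.mem_iUnion₂.1 (ht.2 (L.add_mem ha (L.smul_mem t hy)))
    have haσ : a ∈ σ := by
      by_contra hn
      exact htfar (Set.mem_biUnion (show σ ∈ {σ ∈ Φ.cones | a ∉ σ} from ⟨hσ, hn⟩) hmem)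
    refine ⟨σ, hσ, haσ, ?_⟩
    have := Submodule.sub_mem _ (Submodule.subset_span (R := ℝ) hmem) (Submodule.subset_span haσ)
    rw [add_sub_cancel_left] at this
    exact (Submodule.smul_mem_iff _ (ne_of_gt ht0)).1 this
  obtain ⟨σ, hσ, hLσ⟩ := PointedCone.exists_forall_mem_of_forall_exists_mem
    (L.restrictScalars _ : PointedCone ℝ (Fin m → ℝ)) (Φ.finite.toFinset.filter (a ∈ ·))
    (fun σ => Submodule.span ℝ (σ : Set (Fin m → ℝ))) (fun y hy => by
      obtain ⟨σ, h1, h2, h3⟩ := hcover y hy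
      exact ⟨σ, by simp [h1, h2], h3⟩)
  simp only [Finset.mem_filter, Set.Finite.mem_toFinset] at hσ
  obtain ⟨τ, hστ, hτ⟩ := Φ.finite.exists_le_maximal hσ.1
  refine ⟨τ, hτ, le_antisymm ?_ ?_⟩
  · exact Submodule.span_le.2 fun y hy => hsub τ hτ.1 (hστ hσ.2) y hy
  · exact fun y hy => Submodule.span_mono hστ (hLσ y hy)

/-- The subspace of vectors `x` with `x (f s) = x (g s)` for all `s`. -/
def coordEqSubspace {m : ℕ} {ι : Type*} (f g : ι → Fin m) : Submodule ℝ (Fin m → ℝ) where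
  carrier := {x | ∀ s, x (f s) = x (g s)}
  add_mem' hx hy s := by simp [hx s, hy s]
  zero_mem' s := rfl
  smul_mem' c _ hx s := by simp [hx s]

@[simp]
theorem mem_coordEqSubspace {m : ℕ} {ι : Type*} {f g : ι → Fin m} {x : Fin m → ℝ} :
    x ∈ coordEqSubspace f g ↔ ∀ s, x (f s) = x (g s) := Iff.rfl

/-- The differences `x (f s) - x (g s)` take arbitrary values, already for `x` supported on the
range of `f`. -/
theorem finrank_coordEqSubspace {m : ℕ} {ι : Type*} [Fintype ι] {f g : ι → Fin m}
    (hf : f.Injective) (hfg : ∀ s t, f s ≠ g t) :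
    Module.finrank ℝ (coordEqSubspace f g) + Fintype.card ι = m := by
  classical
  let T : (Fin m → ℝ) →ₗ[ℝ] (ι → ℝ) :=
    LinearMap.funLeft ℝ ℝ f - LinearMap.funLeft ℝ ℝ g
  have hker : LinearMap.ker T = coordEqSubspace f g := by
    ext x
    simp [T, funext_iff, sub_eq_zero, LinearMap.funLeft_apply]
  have hsurj : Function.Surjective T := by
    intro y
    refine ⟨fun i => ∑ s, if f s = i then y s else 0, ?_⟩
    ext s
    simp [T, LinearMap.funLeft_apply, hf.eq_iff, hfg]
  have h := LinearMap.finrank_range_add_finrank_ker T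
  rw [LinearMap.range_eq_top.2 hsurj, finrank_top, hker, Module.finrank_fintype_fun_eq_card,
    Module.finrank_fintype_fun_eq_card, Fintype.card_fin] at h
  omega

/-! ### Cones of a given weak order -/

/-- The cone of all vectors whose coordinates are ordered weakly compatibly with those of `y`. -/
def weakOrderCone {m : ℕ} (y : Fin m → ℝ) : PointedCone ℝ (Fin m → ℝ) where
  carrier := {x | ∀ i j, y i ≤ y j → x i ≤ x j}
  add_mem' hx hz i j hij := add_le_add (hx i j hij) (hz i j hij)
  zero_mem' _ _ _ := le_rfl
  smul_mem' c _ hx i j hij := mul_le_mul_of_nonneg_left (hx i j hij) c.2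

@[simp]
theorem mem_weakOrderCone {m : ℕ} {x y : Fin m → ℝ} :
    x ∈ weakOrderCone y ↔ ∀ i j, y i ≤ y j → x i ≤ x j := Iff.rfl

theorem self_mem_weakOrderCone {m : ℕ} (y : Fin m → ℝ) : y ∈ weakOrderCone y := fun _ _ h => h

theorem isRationalPolyhedralCone_weakOrderCone {m : ℕ} (y : Fin m → ℝ) :
    IsRationalPolyhedralCone (weakOrderCone y) := by
  classical
  refine ⟨(Finset.univ.filter fun q : Fin m × Fin m => y q.1 ≤ y q.2).image
    fun q => Pi.single q.2 1 - Pi.single q.1 1, fun _ => ?_⟩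
  simp only [mem_weakOrderCone, Finset.forall_mem_image, Finset.mem_filter, Finset.mem_univ,
    true_and, Prod.forall]
  simp [sub_mul, Pi.single_apply, Finset.sum_sub_distrib]

theorem finite_range_weakOrderCone (m : ℕ) :
    (Set.range (weakOrderCone : (Fin m → ℝ) → PointedCone ℝ (Fin m → ℝ))).Finite := by
  refine Set.Finite.of_finite_image (f := SetLike.coe) ?_ SetLike.coe_injective.injOn
  refine (Set.finite_range fun r : Fin m → Fin m → Prop =>
    {x : Fin m → ℝ | ∀ i j, r i j → x i ≤ x j}).subset ?_
  rintro _ ⟨_, ⟨y, rfl⟩, rfl⟩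
  exact ⟨fun i j => y i ≤ y j, rfl⟩

/-- Each inequality imposed by `z` either holds throughout the cone of `y` or is reversed there; a
reversed one that holds for a sum holds for each summand. -/
theorem weakOrderCone_inf_isFaceOf {m : ℕ} (y z : Fin m → ℝ) :
    (weakOrderCone y ⊓ weakOrderCone z).IsFaceOf (weakOrderCone y) where
  le := inf_le_left
  mem_of_smul_add_mem := by
    intro x w a hx hw ha hxw
    refine ⟨hx, fun i j hij => ?_⟩
    rcases le_total (y i) (y j) with h | h
    · exact hx i j h
    · have h1 := hxw.2 i j hij
      have h2 := hw j i h
      simp only [Pi.add_apply, Pi.smul_apply, smul_eq_mul] at h1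
      exact le_of_mul_le_mul_left (by linarith) ha

/-- A point `z` of `τ` with the fewest ties between coordinates lies in the relative interior of
`τ`, and its weak order determines the face. -/
theorem exists_eq_weakOrderCone_of_isFaceOf {m : ℕ} {y : Fin m → ℝ} {τ : PointedCone ℝ (Fin m → ℝ)}
    (hτ : τ.IsFaceOf (weakOrderCone y)) : ∃ z ∈ weakOrderCone y, τ = weakOrderCone z := by
  classical
  let E : (Fin m → ℝ) → Finset (Fin m × Fin m) := fun z => Finset.univ.filter fun q => z q.1 = z q.2
  obtain ⟨z, hz, hmin⟩ : ∃ z ∈ τ, ∀ x ∈ τ, (E z).card ≤ (E x).card := by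
    obtain ⟨z, hz, h⟩ := (measure fun x => (E x).card).wf.has_min (τ : Set (Fin m → ℝ))
      ⟨0, τ.zero_mem⟩
    exact ⟨z, hz, fun x hx => not_lt.1 (h x hx)⟩
  have hzy := hτ.le hz
  refine ⟨z, hzy, le_antisymm (fun x hx => ?_) fun x hx => ?_⟩
  · have hxy := hτ.le hx
    have hsub : E (x + z) ⊆ E z := by
      intro q hq
      simp only [E, Finset.mem_filter, Finset.mem_univ, true_and, Pi.add_apply] at hq ⊢
      rcases le_total (y q.1) (y q.2) with h | h
      · linarith [hxy _ _ h, hzy _ _ h]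
      · linarith [hxy _ _ h, hzy _ _ h]
    have heq := Finset.eq_of_subset_of_card_le hsub (hmin _ (τ.add_mem hx hz))
    intro i j hij
    rcases hij.lt_or_eq with h | h
    · exact hxy i j (not_lt.1 fun hlt => h.not_ge (hzy j i hlt.le))
    · have h1 : (i, j) ∈ E (x + z) := by
        rw [heq]
        simp [E, h]
      simp only [E, Finset.mem_filter, Finset.mem_univ, true_and, Pi.add_apply] at h1
      linarith
  · have hxy : x ∈ weakOrderCone y := fun i j hij => hx i j (hzy i j hij)
    -- Strict inequalities of `z` survive a small perturbation, and ties of `z` are ties of `x`.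
    -- Then `z = ε • x + (z - ε • x)` puts `x` into the face.
    obtain ⟨ε, hε, hmem⟩ : ∃ ε > (0 : ℝ), z - ε • x ∈ weakOrderCone y := by
      have : ∀ᶠ ε in nhdsWithin (0 : ℝ) (Set.Ioi 0), ∀ i j, y i ≤ y j →
          (z - ε • x) i ≤ (z - ε • x) j := by
        refine eventually_all.2 fun i => eventually_all.2 fun j => eventually_imp_distrib_left.2
          fun hij => ?_
        rcases (hzy i j hij).lt_or_eq with h | h
        · have hc : Tendsto (fun ε : ℝ => (z - ε • x) j - (z - ε • x) i) (nhds 0)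
              (nhds ((z - (0 : ℝ) • x) j - (z - (0 : ℝ) • x) i)) :=
            Continuous.tendsto (by simp only [Pi.sub_apply, Pi.smul_apply]; fun_prop) 0
          have := (hc.mono_left (nhdsWithin_le_nhds (s := Set.Ioi 0))).eventually
            (lt_mem_nhds (show (0 : ℝ) < _ by simpa using h))
          filter_upwards [this] with ε hε
          exact (sub_pos.1 hε).le
        · have : x i = x j := le_antisymm (hx i j h.le) (hx j i h.ge)
          simp [h, this]
      obtain ⟨ε, h1, h2⟩ := (this.and self_mem_nhdsWithin).exists
      exact ⟨ε, h2, h1⟩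
    exact hτ.mem_of_smul_add_mem hxy hmem hε (by simpa using hz)

/-- A set that contains the weak order cone of each of its points is the support of a fan. -/
theorem exists_rationalFan_support_eq {m : ℕ} {U : Set (Fin m → ℝ)}
    (hU : ∀ y ∈ U, ∀ x ∈ weakOrderCone y, x ∈ U) : ∃ Φ : RationalFan m, Φ.support = U := by
  refine ⟨{
    cones := weakOrderCone '' U
    finite := (finite_range_weakOrderCone m).subset (Set.image_subset_range _ _)
    rational := ?_
    face_mem := ?_
    inter_face := ?_ }, ?_⟩
  · rintro _ ⟨y, -, rfl⟩
    exact isRationalPolyhedralCone_weakOrderCone y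
  · rintro _ ⟨y, hy, rfl⟩ τ hτ
    obtain ⟨z, hz, rfl⟩ := exists_eq_weakOrderCone_of_isFaceOf hτ
    exact ⟨z, hU y hy z hz, rfl⟩
  · rintro _ ⟨y, -, rfl⟩ _ ⟨z, -, rfl⟩
    exact weakOrderCone_inf_isFaceOf y z
  · ext x
    simp only [RationalFan.support, Set.mem_iUnion, Set.mem_image, exists_prop]
    constructor
    · rintro ⟨_, ⟨y, hy, rfl⟩, hx⟩
      exact hU y hy x hx
    · exact fun hx => ⟨_, ⟨x, hx, rfl⟩, self_mem_weakOrderCone x⟩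

/-! ### The universal fan has codimension at least three -/

/-- The combinatorial description of the set of universally singular polynomials. -/
def universalBergmanFan (n : ℕ) : Set (Fin (n + 1) → ℝ) := ⋂ p : FieldChar, bergmanFan p n

theorem mem_universalBergmanFan {n : ℕ} {x : Fin (n + 1) → ℝ} :
    x ∈ universalBergmanFan n ↔ ∀ p : ℕ, p = 0 ∨ p.Prime → x ∈ bergmanFan p n := by
  simp [universalBergmanFan]

theorem universallySingular_eq_universalBergmanFan {K : FieldChar → Type*} [∀ p, Field (K p)]
    [∀ p, IsAlgClosed (K p)] (v : ∀ p, AddValuation (K p) (WithTop ℝ)) (h : ∀ p, CharP (K p) p)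
    (h' : ∀ p, CharP (TropResidueField (v p)) p) (hv : ∀ p, ∃ x : K p, x ≠ 0 ∧ v p x ≠ 0) {n : ℕ}
    (hn : 1 ≤ n) : universallySingular v n = universalBergmanFan n := by
  refine Set.iInter_congr fun p => ?_
  have := h p
  have := h' p
  refine tropDoubleRootSpace_eq_bergmanFan (v p) (hv p) (fun h1 => ?_) hn
  rcases p.2 with h0 | h0
  · omega
  · exact h0.ne_one h1

theorem mem_universalBergmanFan_of_mem_weakOrderCone {n : ℕ} {x y : Fin (n + 1) → ℝ}
    (hy : y ∈ universalBergmanFan n) (hx : x ∈ weakOrderCone y) : x ∈ universalBergmanFan n :=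
  Set.mem_iInter.2 fun p => mem_bergmanFan_of_monotone (Set.mem_iInter.1 hy p) hx

theorem MinAttainedTwice.eq_of_forall {ι : Type*} {S : Set ι} {x : ι → ℝ}
    (h : MinAttainedTwice S x) {i₀ u w : ι} (hi₀ : i₀ ∈ S)
    (huw : ∀ k ∈ S, x k ≤ x i₀ → k = u ∨ k = w) : x u = x w := by
  obtain ⟨i, hi, j, hj, hij, hmin⟩ := h
  have hxij : x i = x j := le_antisymm (hmin j hj).1 (hmin i hi).2
  rcases huw i hi (hmin _ hi₀).1 with rfl | rfl <;> rcases huw j hj (hmin _ hi₀).2 with rfl | rfl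
  · exact absurd rfl hij
  · exact hxij
  · exact hxij.symm
  · exact absurd rfl hij

theorem MinAttainedTwice.exists_eq {ι : Type*} {S : Set ι} {x : ι → ℝ} (h : MinAttainedTwice S x)
    {i₀ : ι} (hi₀ : i₀ ∈ S) (hmin : ∀ k, x i₀ ≤ x k) :
    ∃ i ∈ S, ∃ j ∈ S, i ≠ j ∧ x i = x i₀ ∧ x j = x i₀ := by
  obtain ⟨i, hi, j, hj, hij, h⟩ := h
  exact ⟨i, hi, j, hj, hij, (h _ hi₀).1.antisymm (hmin i), (h _ hi₀).2.antisymm (hmin j)⟩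

/-- Each point of the universal fan lies in one of finitely many subspaces of codimension three. -/
theorem exists_mem_coordEqSubspace_of_mem_universalBergmanFan {n : ℕ} (hn : 1 ≤ n)
    {x : Fin (n + 1) → ℝ} (hx : x ∈ universalBergmanFan n) :
    ∃ f g : Fin 3 → Fin (n + 1), (f.Injective ∧ ∀ s t, f s ≠ g t) ∧ x ∈ coordEqSubspace f g := by
  rw [mem_universalBergmanFan] at hx
  have h0 : ∀ c : Fin (n + 1), MinAttainedTwice {k | k ≠ c} x := fun c => by
    simpa [Nat.ModEq, Fin.val_inj] using hx 0 (.inl rfl) c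
  have h2 := hx 2 (.inr Nat.prime_two)
  obtain ⟨i₀, hi₀⟩ := Finite.exists_min x
  obtain ⟨u, w, huw, hu, hw⟩ : ∃ u w, u ≠ w ∧ x u = x i₀ ∧ x w = x i₀ := by
    have : Nontrivial (Fin (n + 1)) := Fin.nontrivial_iff_two_le.2 (by omega)
    obtain ⟨j, hj⟩ := exists_ne i₀
    obtain ⟨u, -, w, -, huw, h1, h2⟩ := (h0 j).exists_eq (i₀ := i₀) hj.symm hi₀
    exact ⟨u, w, huw, h1, h2⟩
  -- Characteristic `0` with `u` omitted yields three global minimisers `u, y, z`.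
  obtain ⟨y, hy, z, hz, hyz, hxy, hxz⟩ := (h0 u).exists_eq (i₀ := w) huw.symm
    fun k => by rw [hw]; exact hi₀ k
  rw [hw] at hxy hxz
  -- If the minimisers have mixed parity, characteristic `2` gives two of the parity of `k`, beside
  -- `i` and `j`: four equal coordinates.
  have four : ∀ i j k : Fin (n + 1), i ≠ j → x i = x i₀ → x j = x i₀ → x k = x i₀ →
      (i : ℕ) ≡ j [MOD 2] → ¬ (k : ℕ) ≡ i [MOD 2] →
      ∃ f g : Fin 3 → Fin (n + 1), (f.Injective ∧ ∀ s t, f s ≠ g t) ∧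
        x ∈ coordEqSubspace f g := by
    intro i j k hij hi hj hk hmod hkmod
    obtain ⟨r, hr, r', hr', hrr', hxr, hxr'⟩ := (h2 i).exists_eq (i₀ := k) hkmod
      fun k' => by rw [hk]; exact hi₀ k'
    have e1 : r ≠ i := fun h => hr (h ▸ rfl)
    have e2 : r' ≠ i := fun h => hr' (h ▸ rfl)
    have e3 : j ≠ r := fun h => hr (h ▸ hmod.symm)
    have e4 : j ≠ r' := fun h => hr' (h ▸ hmod.symm)
    refine ⟨![j, r, r'], ![i, i, i], ⟨?_, ?_⟩, ?_⟩
    · intro s t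
      fin_cases s <;> fin_cases t <;> simp [e3, e4, hrr', e3.symm, e4.symm, hrr'.symm]
    · intro s t
      fin_cases s <;> fin_cases t <;> simp [e1, e2, hij.symm]
    · intro s
      fin_cases s <;> simp [hi, hj, hk, hxr, hxr']
  have hm : ∀ k : ℕ, k ≡ 0 [MOD 2] ∨ k ≡ 1 [MOD 2] := fun k => k.mod_two_eq_zero_or_one
  by_cases huy : (u : ℕ) ≡ y [MOD 2]
  · by_cases huz : (u : ℕ) ≡ z [MOD 2]
    -- All three minimisers have the same parity, so the third equality comes from the minimum over
    -- the other parity.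
    · obtain ⟨q, hq, r, hr, hqr, hmin⟩ := h2 u
      have e1 : y ≠ q := fun h => hq (h ▸ huy.symm)
      have e2 : z ≠ q := fun h => hq (h ▸ huz.symm)
      have e3 : y ≠ r := fun h => hr (h ▸ huy.symm)
      have e4 : z ≠ r := fun h => hr (h ▸ huz.symm)
      have e5 : q ≠ u := fun h => hq (h ▸ rfl)
      have hxqr : x q = x r := le_antisymm (hmin r hr).1 (hmin q hq).2
      have hy' : y ≠ u := hy
      have hz' : z ≠ u := hz
      refine ⟨![y, z, q], ![u, u, r], ⟨?_, ?_⟩, ?_⟩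
      · intro s t
        fin_cases s <;> fin_cases t <;> simp [e1, e2, hyz, e1.symm, e2.symm, hyz.symm]
      · intro s t
        fin_cases s <;> fin_cases t <;> simp [e3, e4, e5, hqr, hy', hz']
      · intro s
        fin_cases s <;> simp [hxy, hxz, hu, hxqr]
    · exact four u y z (Ne.symm hy) hu hxy hxz huy fun h => huz h.symm
  · by_cases huz : (u : ℕ) ≡ z [MOD 2]
    · exact four u z y (Ne.symm hz) hu hxz hxy huz fun h => huy h.symm
    · refine four y z u hyz hxy hxz hu ?_ huy
      simp only [Nat.ModEq] at *
      omega

theorem three_le_coneCodim {n : ℕ} (hn : 1 ≤ n) {σ : PointedCone ℝ (Fin (n + 1) → ℝ)}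
    (hσ : ∀ x ∈ σ, x ∈ universalBergmanFan n) : 3 ≤ coneCodim σ := by
  classical
  obtain ⟨⟨f, g⟩, hfg, hle⟩ := σ.exists_forall_mem_of_forall_exists_mem
    (Finset.univ.filter fun q : (Fin 3 → Fin (n + 1)) × (Fin 3 → Fin (n + 1)) =>
      q.1.Injective ∧ ∀ s t, q.1 s ≠ q.2 t) (fun q => coordEqSubspace q.1 q.2) (fun x hx => by
      obtain ⟨f, g, hfg, h⟩ := exists_mem_coordEqSubspace_of_mem_universalBergmanFan hn (hσ x hx)
      exact ⟨(f, g), by simpa using hfg, h⟩)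
  have h1 := Submodule.finrank_mono (Submodule.span_le.2 hle)
  have hfg' := (Finset.mem_filter.1 hfg).2
  have h2 := finrank_coordEqSubspace hfg'.1 hfg'.2
  rw [Fintype.card_fin] at h2
  rw [coneCodim]
  simp only at h1 h2
  omega

/-! ### Points where the universal fan is locally linear -/

/-- Near a suitable point, the universal fan is a linear space of codimension `k + 2`, when twice a
product of `k` distinct primes, two among them, is at most `n`. -/
theorem exists_eventually_mem_universalBergmanFan_iff {n k P : ℕ} {q R : Fin k → ℕ}
    (hq : ∀ s, (q s).Prime) (h2 : 2 ∣ P) (hPn : 2 * P ≤ n) (hP0 : 0 < P)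
    (hPR : ∀ s, P = q s * R s) (hR : ∀ s, ¬ q s ∣ R s) (hR' : ∀ s t, s ≠ t → q t ∣ R s)
    (hall : ∀ p, p.Prime → p ∣ P → ∃ s, q s = p) :
    ∃ (a : Fin (n + 1) → ℝ) (L : Submodule ℝ (Fin (n + 1) → ℝ)), a ∈ L ∧
      Module.finrank ℝ L + (k + 2) = n + 1 ∧
      ∀ᶠ x in nhds a, x ∈ universalBergmanFan n ↔ x ∈ L := by
  classical
  have hqP : ∀ s, q s ∣ P := fun s => ⟨_, hPR s⟩
  have hRP : ∀ s, R s ≤ P := fun s => Nat.le_of_dvd hP0 ⟨q s, by rw [mul_comm]; exact hPR s⟩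
  let o : Fin (n + 1) := 0
  let b : Fin (n + 1) := ⟨P, by omega⟩
  let d : Fin (n + 1) := ⟨2 * P, by omega⟩
  let r : Fin k → Fin (n + 1) := fun s => ⟨R s, by have := hRP s; omega⟩
  let g : Fin k → Fin (n + 1) := fun s => ⟨2 * P - R s, by omega⟩
  have hob : o ≠ b := by simp [o, b, Fin.ext_iff]; omega
  have hod : o ≠ d := by simp [o, d, Fin.ext_iff]; omega
  have hbd : b ≠ d := by simp [b, d, Fin.ext_iff]; omega
  have hO : ∀ i : Fin (n + 1), i = o ∨ i = b ∨ i = d → ∀ s, q s ∣ (i : ℕ) := by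
    rintro i (rfl | rfl | rfl) s
    · exact dvd_zero _
    · exact hqP s
    · exact (hqP s).mul_left 2
  -- Among the chosen primes, only `q t` fails to divide the indices of the pair `r t`, `g t`.
  have hrg : ∀ s t, ∀ i : Fin (n + 1), i = r t ∨ i = g t → (¬ q s ∣ (i : ℕ) ↔ s = t) := by
    rintro s t i (rfl | rfl)
    · exact ⟨fun h => by_contra fun hst => h (hR' t s (Ne.symm hst)), fun h => h ▸ hR t⟩
    · have : q s ∣ 2 * P - R t ↔ q s ∣ R t :=
        Nat.dvd_sub_iff_right (by have := hRP t; omega) ((hqP s).mul_left 2)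
      simp only [g, this]
      exact ⟨fun h => by_contra fun hst => h (hR' t s (Ne.symm hst)), fun h => h ▸ hR t⟩
  have hrg_ne : ∀ s, r s ≠ g s := by
    intro s h
    have h1 : R s = 2 * P - R s := congrArg Fin.val h
    have h2 : R s = P := by have := hRP s; omega
    exact hR s (h2 ▸ hqP s)
  let a : Fin (n + 1) → ℝ := fun i =>
    if i = o ∨ i = b ∨ i = d then 0 else if ∃ s, i = r s ∨ i = g s then 1 else 2
  have ha0 : ∀ i, i = o ∨ i = b ∨ i = d → a i = 0 := fun i hi => if_pos hi
  have ha1 : ∀ s i, i = r s ∨ i = g s → a i = 1 := fun s i hi => by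
    have h1 : ¬ (i = o ∨ i = b ∨ i = d) := fun h => (hrg s s i hi).2 rfl (hO i h s)
    simp only [a, if_neg h1]
    exact if_pos ⟨s, hi⟩
  have ha : ∀ i, (i = o ∨ i = b ∨ i = d) ∨ (∃ s, i = r s ∨ i = g s) ∨ a i = 2 := fun i => by
    by_cases h1 : i = o ∨ i = b ∨ i = d
    · exact .inl h1
    · by_cases h2 : ∃ s, i = r s ∨ i = g s
      · exact .inr (.inl h2)
      · exact .inr (.inr (by simp only [a, if_neg h1, if_neg h2]))
  let F : Bool ⊕ Fin k → Fin (n + 1) := Sum.elim (fun e => if e then b else d) r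
  let G : Bool ⊕ Fin k → Fin (n + 1) := Sum.elim (fun _ => o) g
  have hrO : ∀ s, ¬ (r s = o ∨ r s = b ∨ r s = d) := fun s h =>
    (hrg s s (r s) (.inl rfl)).2 rfl (hO _ h s)
  have hgO : ∀ s, ¬ (g s = o ∨ g s = b ∨ g s = d) := fun s h =>
    (hrg s s (g s) (.inr rfl)).2 rfl (hO _ h s)
  push Not at hrO hgO
  have hFinj : F.Injective := by
    rintro (e | s) (e' | t) h
    · cases e <;> cases e'
      exacts [rfl, absurd h hbd.symm, absurd h hbd, rfl]
    · cases e
      exacts [absurd h.symm (hrO t).2.2, absurd h.symm (hrO t).2.1]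
    · cases e'
      exacts [absurd h (hrO s).2.2, absurd h (hrO s).2.1]
    · exact congrArg _ ((hrg s t (r s) (.inl h)).1 ((hrg s s _ (.inl rfl)).2 rfl))
  have hFG : ∀ s t, F s ≠ G t := by
    rintro (e | s) (e' | t)
    · cases e
      · exact hod.symm
      · exact hob.symm
    · cases e
      · exact (hgO t).2.2.symm
      · exact (hgO t).2.1.symm
    · exact (hrO s).1
    · intro h
      obtain rfl : s = t := (hrg s t (r s) (.inr h)).1 ((hrg s s _ (.inl rfl)).2 rfl)
      exact hrg_ne s h
  have hL : ∀ x : Fin (n + 1) → ℝ, x ∈ coordEqSubspace F G ↔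
      (x b = x o ∧ x d = x o) ∧ ∀ s, x (r s) = x (g s) := by
    intro x
    simp [F, G, and_comm]
  refine ⟨a, coordEqSubspace F G, ?_, ?_, ?_⟩
  · rw [hL]
    refine ⟨⟨?_, ?_⟩, fun s => ?_⟩
    · rw [ha0 b (by simp), ha0 o (by simp)]
    · rw [ha0 d (by simp), ha0 o (by simp)]
    · rw [ha1 s _ (.inl rfl), ha1 s _ (.inr rfl)]
  · have := finrank_coordEqSubspace hFinj hFG
    simp only [Fintype.card_sum, Fintype.card_bool, Fintype.card_fin] at this
    omega
  -- Radius `1 / 4` keeps the levels `0`, `1`, `2` separated, with thresholds `1 / 2` and `3 / 2`.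
  filter_upwards [Metric.ball_mem_nhds a (show (0 : ℝ) < 1 / 4 by norm_num)] with x hx
  rw [Metric.mem_ball, dist_pi_lt_iff (by norm_num)] at hx
  have hx1 : ∀ i, x i < a i + 1 / 4 := fun i => by
    have := (abs_lt.1 (hx i)).2
    linarith
  have hx2 : ∀ i, a i - 1 / 4 < x i := fun i => by
    have := (abs_lt.1 (hx i)).1
    linarith
  have hlow : ∀ i, x i < 1 / 2 → i = o ∨ i = b ∨ i = d := by
    intro i hi
    rcases ha i with h | ⟨s, h⟩ | h
    · exact h
    · linarith [hx2 i, ha1 s i h]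
    · linarith [hx2 i]
  have hmid : ∀ i, x i < 3 / 2 → (i = o ∨ i = b ∨ i = d) ∨ ∃ s, i = r s ∨ i = g s := by
    intro i hi
    rcases ha i with h | h | h
    · exact .inl h
    · exact .inr h
    · linarith [hx2 i]
  rw [hL, mem_universalBergmanFan]
  constructor
  · intro hU
    have h0 : ∀ c : Fin (n + 1), MinAttainedTwice {k | k ≠ c} x := fun c => by
      simpa [Nat.ModEq, Fin.val_inj] using hU 0 (.inl rfl) c
    have hxb : x b < 1 / 4 := by linarith [hx1 b, ha0 b (by simp)]
    have hxo : x o < 1 / 4 := by linarith [hx1 o, ha0 o (by simp)]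
    have e1 : x b = x d := (h0 o).eq_of_forall (i₀ := b) hob.symm fun i hi hib => by
      rcases hlow i (by linarith) with h | h | h
      · exact absurd h hi
      · exact .inl h
      · exact .inr h
    have e2 : x o = x d := (h0 b).eq_of_forall (i₀ := o) hob fun i hi hib => by
      rcases hlow i (by linarith) with h | h | h
      · exact .inl h
      · exact absurd h hi
      · exact .inr h
    refine ⟨⟨e1.trans e2.symm, e2.symm⟩, fun s => ?_⟩
    have hdvd : ∀ i : Fin (n + 1), ¬ (i : ℕ) ≡ (o : ℕ) [MOD q s] ↔ ¬ q s ∣ (i : ℕ) := fun i =>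
      not_congr Nat.modEq_zero_iff_dvd
    refine (hU (q s) (.inr (hq s)) o).eq_of_forall (i₀ := r s) ?_ fun i hi his => ?_
    · exact (hdvd _).2 (hR s)
    · have hi' := (hdvd i).1 hi
      rcases hmid i (by linarith [hx1 (r s), ha1 s (r s) (.inl rfl)]) with h | ⟨t, h⟩
      · exact absurd (hO i h s) hi'
      · obtain rfl := (hrg s t i h).1 hi'
        exact h
  · rintro ⟨⟨hxb, hxd⟩, hxs⟩ p hp c
    have hmin : ∀ i, x o ≤ x i := by
      intro i
      by_cases h : x i < 1 / 2
      · rcases hlow i h with rfl | rfl | rfl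
        exacts [le_rfl, hxb.ge, hxd.ge]
      · linarith [hx1 o, ha0 o (by simp)]
    have hwit : ∀ i j : Fin (n + 1), i ≠ j → x i = x o → x j = x o → ¬ (i : ℕ) ≡ c [MOD p] →
        ¬ (j : ℕ) ≡ c [MOD p] → MinAttainedTwice {k : Fin (n + 1) | ¬ (k : ℕ) ≡ c [MOD p]} x :=
      fun i j hij hi hj hic hjc => ⟨i, hic, j, hjc, hij, fun k _ => by rw [hi, hj]; simp [hmin k]⟩
    by_cases hpP : p.Prime ∧ p ∣ P
    · obtain ⟨s, rfl⟩ := hall p hpP.1 hpP.2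
      by_cases hc : q s ∣ (c : ℕ)
      · have hdvd : ∀ i : Fin (n + 1), ¬ (i : ℕ) ≡ (c : ℕ) [MOD q s] ↔ ¬ q s ∣ (i : ℕ) := fun i =>
          not_congr ⟨fun h => (h.dvd_iff dvd_rfl).2 hc,
            fun h => (Nat.modEq_zero_iff_dvd.2 h).trans (Nat.modEq_zero_iff_dvd.2 hc).symm⟩
        have hle : ∀ i : Fin (n + 1), ¬ q s ∣ (i : ℕ) → x (r s) ≤ x i := by
          intro i hi
          by_cases h : x i < 3 / 2
          · rcases hmid i h with h | ⟨t, h⟩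
            · exact absurd (hO i h s) hi
            · obtain rfl := (hrg s t i h).1 hi
              rcases h with rfl | rfl
              exacts [le_rfl, (hxs s).le]
          · linarith [hx1 (r s), ha1 s (r s) (.inl rfl)]
        refine ⟨r s, (hdvd _).2 (hR s), g s, (hdvd _).2 ((hrg s s _ (.inr rfl)).2 rfl), hrg_ne s,
          fun i hi => ⟨hle i ((hdvd i).1 hi), ?_⟩⟩
        rw [← hxs s]
        exact hle i ((hdvd i).1 hi)
      · have hne : ∀ i : Fin (n + 1), q s ∣ (i : ℕ) → ¬ (i : ℕ) ≡ c [MOD q s] := fun i hi h =>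
          hc ((h.dvd_iff dvd_rfl).1 hi)
        exact hwit o b hob rfl hxb (hne _ (hO o (by simp) s)) (hne _ (hO b (by simp) s))
    -- Here `0, P, 2P` are pairwise incongruent modulo `p`, so at most one is excluded. For `p = 2`
    -- this case cannot occur, as `2 ∣ P`.
    · have hpP' : ¬ p ∣ P := fun h => by
        rcases hp with rfl | hp
        · exact hP0.ne' (Nat.eq_zero_of_zero_dvd h)
        · exact hpP ⟨hp, h⟩
      have hp2P : ¬ p ∣ 2 * P := fun h => by
        rcases hp with rfl | hp
        · have := Nat.eq_zero_of_zero_dvd h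
          omega
        · rcases hp.dvd_mul.1 h with h | h
          · exact hpP' (h.trans h2)
          · exact hpP' h
      have m1 : ¬ (o : ℕ) ≡ b [MOD p] := fun h => hpP' (Nat.modEq_zero_iff_dvd.1 h.symm)
      have m2 : ¬ (o : ℕ) ≡ d [MOD p] := fun h => hp2P (Nat.modEq_zero_iff_dvd.1 h.symm)
      have m3 : ¬ (b : ℕ) ≡ d [MOD p] := fun h => hpP' (by
        have := (Nat.modEq_iff_dvd' (show P ≤ 2 * P by omega)).1 h
        rwa [show 2 * P - P = P by omega] at this)
      by_cases ho : (o : ℕ) ≡ c [MOD p]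
      · exact hwit b d hbd hxb hxd (fun h => m1 (ho.trans h.symm)) fun h => m2 (ho.trans h.symm)
      · by_cases hb : (b : ℕ) ≡ c [MOD p]
        · exact hwit o d hod rfl hxd ho fun h => m3 (hb.trans h.symm)
        · exact hwit o b hob rfl hxb ho hb

/-! ### Products of the first primes and their growth -/

theorem firstPrimesProd_pos (k : ℕ) : 0 < firstPrimesProd k :=
  Finset.prod_pos fun i _ => (Nat.prime_nth_prime i).pos

theorem RationalFan.exists_isMaximalFace_coneCodim_eq {n k : ℕ} (hk : 1 ≤ k)
    (hkn : 2 * firstPrimesProd k ≤ n) (Φ : RationalFan (n + 1))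
    (hΦ : Φ.support = universalBergmanFan n) : ∃ σ, Φ.IsMaximalFace σ ∧ coneCodim σ = k + 2 := by
  classical
  have hinj : Function.Injective (Nat.nth Nat.Prime) :=
    Nat.nth_injective Nat.infinite_setOfPred_prime
  have hdvd : ∀ p, p.Prime → ∀ s : Finset ℕ, p ∣ ∏ i ∈ s, Nat.nth Nat.Prime i ↔
      ∃ i ∈ s, Nat.nth Nat.Prime i = p := by
    intro p hp s
    rw [hp.prime.dvd_finsetProd_iff]
    exact exists_congr fun i => and_congr_right fun _ =>
      ⟨fun h => ((Nat.prime_dvd_prime_iff_eq hp (Nat.prime_nth_prime i)).1 h).symm,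
        fun h => h ▸ dvd_rfl⟩
  obtain ⟨a, L, haL, hL, h⟩ := exists_eventually_mem_universalBergmanFan_iff (n := n) (k := k)
    (P := firstPrimesProd k) (q := fun s => Nat.nth Nat.Prime s)
    (R := fun s => ∏ i ∈ (Finset.range k).erase s, Nat.nth Nat.Prime i)
    (fun s => Nat.prime_nth_prime s)
    ((hdvd 2 Nat.prime_two _).2 ⟨0, Finset.mem_range.2 hk, Nat.nth_prime_zero_eq_two⟩) hkn
    (firstPrimesProd_pos k)
    (fun s => (Finset.mul_prod_erase _ _ (Finset.mem_range.2 s.2)).symm)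
    (fun s h => by
      obtain ⟨i, hi, h⟩ := (hdvd _ (Nat.prime_nth_prime s) _).1 h
      exact (Finset.mem_erase.1 hi).1 (hinj h))
    (fun s t hst => (hdvd _ (Nat.prime_nth_prime t) _).2
      ⟨t, Finset.mem_erase.2 ⟨fun h => hst (Fin.ext h.symm), Finset.mem_range.2 t.2⟩, rfl⟩)
    (fun p hp h => by
      obtain ⟨i, hi, h⟩ := (hdvd _ hp _).1 h
      exact ⟨⟨i, Finset.mem_range.1 hi⟩, h⟩)
  rw [← hΦ] at h
  obtain ⟨σ, hσ, hspan⟩ := Φ.exists_isMaximalFace_span_eq L haL h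
  refine ⟨σ, hσ, ?_⟩
  rw [coneCodim, hspan]
  omega

theorem two_pow_le_firstPrimesProd (k : ℕ) : 2 ^ k ≤ firstPrimesProd k := by
  have := Finset.prod_le_prod' (s := Finset.range k) (f := fun _ => 2) (g := Nat.nth Nat.Prime)
    fun i _ => (Nat.prime_nth_prime i).two_le
  simpa [firstPrimesProd] using this

theorem two_mul_firstPrimesProd_maxPrimeCount_le {n : ℕ} (hn : 2 ≤ n) :
    2 * firstPrimesProd (maxPrimeCount n) ≤ n :=
  Nat.findGreatest_spec (P := fun k => 2 * firstPrimesProd k ≤ n) (Nat.zero_le n)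
    (by simpa [firstPrimesProd] using hn)

theorem two_pow_maxPrimeCount_le {n : ℕ} (hn : 2 ≤ n) : 2 * 2 ^ maxPrimeCount n ≤ n :=
  (Nat.mul_le_mul_left 2 (two_pow_le_firstPrimesProd _)).trans
    (two_mul_firstPrimesProd_maxPrimeCount_le hn)

theorem lt_two_mul_firstPrimesProd {n : ℕ} (hn : 2 ≤ n) :
    n < 2 * firstPrimesProd (maxPrimeCount n + 1) := by
  refine not_le.1 (Nat.findGreatest_is_greatest (P := fun k => 2 * firstPrimesProd k ≤ n) (n := n)
    (Nat.lt_succ_self _) ?_)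
  have h1 := two_pow_maxPrimeCount_le hn
  have h2 := Nat.lt_two_pow_self (n := maxPrimeCount n)
  omega

/-- A polynomial bound for the `k`-th prime, from Chebyshev's lower bound for `π`. -/
theorem nth_prime_le_pow (k : ℕ) : Nat.nth Nat.Prime k ≤ (k + 2) ^ 8 := by
  set p := Nat.nth Nat.Prime k with hp
  have hp2 : 2 ≤ p := (Nat.prime_nth_prime k).two_le
  have hπ : Nat.primeCounting p = k + 1 := by
    rw [Nat.primeCounting_eq_primeCounting'_succ, Nat.primeCounting', Nat.count_succ,
      if_pos (Nat.prime_nth_prime k), ← Nat.primeCounting', Nat.primeCounting'_nth_eq]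
  have hp2' : (2 : ℝ) ≤ p := by exact_mod_cast hp2
  have hlogp : 0 < Real.log p := Real.log_pos (by linarith)
  have h1 := Chebyshev.pi_ge p
  rw [hπ, div_le_iff₀ hlogp] at h1
  push_cast at h1
  -- The error term of Chebyshev's bound costs two further multiples of `log p`, turning `k + 1`
  -- into `k + 3`.
  have h2 : Real.log (p + 1) ≤ 2 * Real.log p := by
    rw [← Real.log_rpow (by linarith)]
    refine Real.log_le_log (by linarith) ?_
    norm_num
    nlinarith
  have h3 : Real.log p ≤ 2 * √p := by
    have := Real.log_le_sub_one_of_pos (Real.sqrt_pos.2 (show (0 : ℝ) < p by linarith))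
    rw [Real.log_sqrt (by linarith)] at this
    linarith
  have h4 : (1 : ℝ) / 2 ≤ Real.log 2 := by linarith [Real.log_two_gt_d9]
  have hk : (0 : ℝ) ≤ k := Nat.cast_nonneg k
  have hs : 0 < √(p : ℝ) := Real.sqrt_pos.2 (by linarith)
  have hss : √(p : ℝ) * √p = p := Real.mul_self_sqrt (by linarith)
  have h5 : (p : ℝ) * (1 / 2) ≤ (k + 3) * (2 * √p) :=
    calc (p : ℝ) * (1 / 2) ≤ p * Real.log 2 := by gcongr
      _ ≤ (k + 3) * Real.log p := by linarith
      _ ≤ (k + 3) * (2 * √p) := by gcongr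
  have h6 : √(p : ℝ) ≤ 4 * (k + 3) := by
    rw [← hss] at h5
    by_contra! h
    nlinarith
  have h7 : (p : ℝ) ≤ (4 * (k + 3)) ^ 2 := by
    rw [← hss, pow_two]
    gcongr
  have h8 : p ≤ (4 * (k + 3)) ^ 2 := by exact_mod_cast h7
  refine h8.trans ?_
  have h9 : 4 * (k + 3) ≤ (k + 2) ^ 4 := by nlinarith [sq_nonneg (k ^ 2), Nat.zero_le k]
  calc (4 * (k + 3)) ^ 2 ≤ ((k + 2) ^ 4) ^ 2 := Nat.pow_le_pow_left h9 2
    _ = (k + 2) ^ 8 := by ring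

theorem firstPrimesProd_succ_le (k : ℕ) : firstPrimesProd (k + 1) ≤ ((k + 2) ^ 8) ^ (k + 1) := by
  have := Finset.prod_le_prod' (s := Finset.range (k + 1)) (f := Nat.nth Nat.Prime)
    (g := fun _ => (k + 2) ^ 8) fun i hi => (nth_prime_le_pow i).trans
      (Nat.pow_le_pow_left (by have := Finset.mem_range.1 hi; omega) 8)
  simpa [firstPrimesProd] using this

/-- Maximality of `k` bounds `n` by twice a product of `k + 1` primes, each at most `(k + 2) ^ 8`;
the factor `2` is absorbed into one more such power. -/
theorem log_le_mul_log {n : ℕ} (hn : 2 ≤ n) : Real.log n ≤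
    8 * ((maxPrimeCount n + 2 : ℕ) : ℝ) * Real.log ((maxPrimeCount n + 2 : ℕ) : ℝ) := by
  set k := maxPrimeCount n with hk
  have h1 : n ≤ (k + 2) ^ (8 * (k + 2)) :=
    calc n ≤ 2 * firstPrimesProd (k + 1) := (lt_two_mul_firstPrimesProd hn).le
      _ ≤ (k + 2) ^ 8 * ((k + 2) ^ 8) ^ (k + 1) :=
        Nat.mul_le_mul ((by omega : 2 ≤ k + 2).trans (Nat.le_self_pow (by norm_num) _))
          (firstPrimesProd_succ_le k)
      _ = (k + 2) ^ (8 * (k + 2)) := by rw [← pow_mul, ← pow_add]; congr 1; ring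
  have h2 : (n : ℝ) ≤ ((k + 2 : ℕ) : ℝ) ^ (8 * (k + 2)) := by exact_mod_cast h1
  refine (Real.log_le_log (by exact_mod_cast (by omega : 0 < n)) h2).trans_eq ?_
  rw [Real.log_pow]
  push_cast
  ring

theorem isBigO_maxPrimeCount_log :
    (fun n : ℕ => ((maxPrimeCount n + 2 : ℕ) : ℝ)) =O[atTop] fun n : ℕ => Real.log n := by
  refine IsBigO.of_bound 4 ?_
  filter_upwards [eventually_ge_atTop 2] with n hn
  have h1 : (2 : ℝ) ^ (maxPrimeCount n + 1) ≤ n := by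
    rw [pow_succ']
    exact_mod_cast two_pow_maxPrimeCount_le hn
  have h2 := Real.log_le_log (by positivity) h1
  rw [Real.log_pow] at h2
  have h3 : (1 : ℝ) / 2 ≤ Real.log 2 := by linarith [Real.log_two_gt_d9]
  have h4 : (0 : ℝ) ≤ maxPrimeCount n := Nat.cast_nonneg _
  push_cast at h2 ⊢
  rw [Real.norm_of_nonneg (by linarith), Real.norm_of_nonneg (by positivity)]
  nlinarith

theorem isBigO_log_div_log_log_maxPrimeCount :
    (fun n : ℕ => Real.log n / Real.log (Real.log n)) =O[atTop]
      fun n : ℕ => ((maxPrimeCount n + 2 : ℕ) : ℝ) := by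
  refine IsBigO.of_bound 8 ?_
  have hlog : Tendsto (fun n : ℕ => Real.log (Real.log n)) atTop atTop :=
    Real.tendsto_log_atTop.comp (Real.tendsto_log_atTop.comp tendsto_natCast_atTop_atTop)
  filter_upwards [hlog.eventually_ge_atTop 1, eventually_ge_atTop 2] with n h1 hn
  have hL : 0 < Real.log n := Real.log_pos (by exact_mod_cast hn)
  have hm : (0 : ℝ) < ((maxPrimeCount n + 2 : ℕ) : ℝ) := by positivity
  rw [Real.norm_of_nonneg (by positivity), Real.norm_of_nonneg hm.le, div_le_iff₀ (by linarith)]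
  -- If the codimension is at most `log n`, its logarithm is at most `log (log n)`; otherwise the
  -- bound is immediate from `log (log n) ≥ 1`.
  rcases le_total ((maxPrimeCount n + 2 : ℕ) : ℝ) (Real.log n) with h | h
  · refine (log_le_mul_log hn).trans ?_
    gcongr
  · nlinarith

/-! ### The main theorem -/

theorem mainTheorem8 :
    ((fun n : ℕ => ((maxPrimeCount n + 2 : ℕ) : ℝ)) =O[atTop] fun n : ℕ => Real.log n) ∧
    ((fun n : ℕ => Real.log n / Real.log (Real.log n)) =O[atTop]
      fun n : ℕ => ((maxPrimeCount n + 2 : ℕ) : ℝ)) ∧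
    ∃ N : ℕ, ∀ n ≥ N, ∀ (K : FieldChar → Type*) [∀ p, Field (K p)] [∀ p, IsAlgClosed (K p)]
      (v : ∀ p, AddValuation (K p) (WithTop ℝ)),
      (∀ p, CharP (K p) p) → (∀ p, CharP (TropResidueField (v p)) p) →
      (∀ p, ∃ x : K p, x ≠ 0 ∧ v p x ≠ 0) →
      (∃ Φ : RationalFan (n + 1), Φ.support = universallySingular v n) ∧
      ∀ Φ : RationalFan (n + 1), Φ.support = universallySingular v n →
        Φ.HasCodim 3 ∧ ¬ Φ.IsPure ∧
        (∃ σ, Φ.IsMaximalFace σ ∧ coneCodim σ = maxPrimeCount n + 2) ∧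
        ∀ k, 1 ≤ k → 2 * firstPrimesProd k ≤ n →
          ∃ σ, Φ.IsMaximalFace σ ∧ coneCodim σ = k + 2 := by
  -- The threshold is `12 = 2 * 2 * 3`, from which on `k = 1` and `k = 2` give maximal faces of
  -- codimensions `3` and `4`.
  refine ⟨isBigO_maxPrimeCount_log, isBigO_log_div_log_log_maxPrimeCount, 12, ?_⟩
  intro n hn K _ _ v hchar hres hv
  rw [universallySingular_eq_universalBergmanFan v hchar hres hv (by omega)]
  refine ⟨exists_rationalFan_support_eq fun y hy x hx =>
    mem_universalBergmanFan_of_mem_weakOrderCone hy hx, fun Φ hΦ => ?_⟩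
  have hface : ∀ k, 1 ≤ k → 2 * firstPrimesProd k ≤ n →
      ∃ σ, Φ.IsMaximalFace σ ∧ coneCodim σ = k + 2 := fun k hk hkn =>
    Φ.exists_isMaximalFace_coneCodim_eq hk hkn hΦ
  have hP1 : firstPrimesProd 1 = 2 := by
    simp [firstPrimesProd, Nat.nth_prime_zero_eq_two]
  have hP2 : firstPrimesProd 2 = 6 := by
    simp [firstPrimesProd, Finset.prod_range_succ, Nat.nth_prime_zero_eq_two,
      Nat.nth_prime_one_eq_three]
  obtain ⟨σ, hσ, hσ3⟩ := hface 1 le_rfl (by omega)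
  obtain ⟨τ, hτ, hτ4⟩ := hface 2 one_le_two (by omega)
  refine ⟨⟨⟨σ, hσ.1, hσ3⟩, ?_⟩, ?_, ?_, hface⟩
  · rintro _ ⟨ρ, hρ, rfl⟩
    exact three_le_coneCodim (by omega) fun x hx => hΦ ▸ Set.mem_biUnion hρ hx
  · rintro ⟨c, hc⟩
    have h3 := hc σ hσ
    have h4 := hc τ hτ
    omega
  · refine hface _ ?_ (two_mul_firstPrimesProd_maxPrimeCount_le (by omega))
    exact Nat.le_findGreatest (P := fun k => 2 * firstPrimesProd k ≤ n) (by omega) (by omega)
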